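/- There is a universal constant $C>0$ such that the following holds. Let $M,N\ge 1$ be integers, let $Q\subset\mathbb R^N$ be a nonempty subset of the closed Euclidean unit ball, and let $E\subset\mathbb R^M$ be a nonempty set with permutation symmetry, i.e. for every permutation $\pi$ of $\{1,\dots,M\}$ and every $x\in\mathbb R^M$, $(x_1,\dots,x_M)\in E$ if and only if $(x_{\pi(1)},\dots,x_{\pi(M)})\in E$. Let $A$ be a random $M\times N$ matrix with independent standard normal entries. For $q\in[2,\infty]$ define the $\ell^q$-margin $$\mathcal M_q(A)=\inf_{\sigma\in Q} d_q(A\sigma,E),\qquad d_q(x,E)=\inf_{y\in E}\|x-y\|_q .$$ Then for every $q\in[2,\infty]$ the random variable $\mathcal M_q(A)$ has a finite second moment and $$\mathrm{Var}(\mathcal M_q(A))\le \frac{C}{1+\left(\frac12-\frac1q\right)\log M},$$ where $1/q=0$ when $q=\infty$. -/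

import Mathlib

open MeasureTheory ProbabilityTheory
open scoped ENNReal Matrix

noncomputable section

/-- A random `M × N` real matrix `A`, defined on the measure space `(Ω, P)`, is a standard Gaussian
matrix: its entries are independent and each has law `N(0, 1)`. -/
def IsStdGaussianMatrix {Ω : Type*} [MeasurableSpace Ω] {M N : ℕ}
    (A : Ω → Matrix (Fin M) (Fin N) ℝ) (P : Measure Ω) : Prop :=
  (∀ i j, HasLaw (fun ω => A ω i j) (gaussianReal 0 1) P) ∧
    iIndepFun (fun (p : Fin M × Fin N) ω => A ω p.1 p.2) P

/-- Permutation symmetry of `E ⊆ ℝ^M`: `(x_1, …, x_M) ∈ E` if and only if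
`(x_{π(1)}, …, x_{π(M)}) ∈ E`, for every permutation `π` of the coordinates. -/
def PermutationSymmetric {M : ℕ} (E : Set (Fin M → ℝ)) : Prop :=
  ∀ (π : Equiv.Perm (Fin M)) (x : Fin M → ℝ), x ∈ E ↔ (fun i => x (π i)) ∈ E

/-- The `ℓ^q` distance `d_q(x, E) = inf_{y ∈ E} ‖x - y‖_q` from a point `x` of `ℝ^M` to a nonempty
set `E ⊆ ℝ^M`; for `q = ∞` the norm is the maximum norm. -/
def lqDist {M : ℕ} (q : ℝ≥0∞) (x : Fin M → ℝ) (E : Set (Fin M → ℝ)) : ℝ :=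
  ⨅ y : E, ‖WithLp.toLp q (x - (y : Fin M → ℝ))‖

/-- The `ℓ^q` margin `M_q(A) = inf_{σ ∈ Q} d_q(A σ, E)` of a matrix `A`, for a nonempty feasible
set `Q ⊆ ℝ^N` and a nonempty constraint set `E ⊆ ℝ^M`. -/
def margin {M N : ℕ} (q : ℝ≥0∞) (Q : Set (EuclideanSpace ℝ (Fin N))) (E : Set (Fin M → ℝ))
    (A : Matrix (Fin M) (Fin N) ℝ) : ℝ :=
  ⨅ σ : Q, lqDist q (A *ᵥ (σ : EuclideanSpace ℝ (Fin N)).ofLp) E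

end

/-! The margin `f`, as a function of the matrix, has two Lipschitz bounds: constant 1 for the
Frobenius norm (as `q ≥ 2`), and constant `L = M^(1/q)` for the largest Euclidean row norm. The
first gives `|∇f| ≤ 1`. By duality the second gives `∑ i, |∇ᵢ f| ≤ L`, where `∇ᵢ` is the gradient in
row `i`. Since `E` is permutation symmetric, `f` is invariant under row permutations, so all the
expectations of `|∇ᵢ f|` agree and are at most `L / M`. Hence the squared `L¹` norms of the partial
derivatives add up to at most `L² / M`, far below the `L²` energy bound 1 when `M` is large and `q >
2`.

Talagrand's `L¹`-`L²` principle turns this gap into a logarithmic gain: `Var f * (1 + log c) ≤ 4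
E|∇f|² + c ∑ k, (E|∂ₖ f|)²` for every `c > 0`, applied with `c = M / L²`. The inequality is proved
on the Boolean cube (`variance_cube_le`) from a logarithmic Sobolev inequality and an entropy lower
bound. It is evaluated at normalized sums of signs (`variance_comp_signSum_le`) and passes to
Gaussian matrices by the central limit theorem (`gaussian_variance_le_of_smooth`). Truncation and
mollification, which preserve both Lipschitz bounds and the symmetry, remove boundedness and
smoothness (`gaussian_variance_le`). -/

open scoped BigOperators

/-! ### The `L¹`-`L²` inequality on the Boolean cube -/

/-- The discrete derivative in direction `k` of a function on the Boolean cube. -/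
noncomputable def cubeDiff {K : Type*} [DecidableEq K] (k : K) (f : (K → Bool) → ℝ) (x : K → Bool) : ℝ :=
  (f (Function.update x k true) - f (Function.update x k false)) / 2

lemma cubeDiff_succ_cons {m : ℕ} (k : Fin m) (f : (Fin (m + 1) → Bool) → ℝ) (b : Bool)
    (x : Fin m → Bool) :
    cubeDiff k.succ f (Fin.cons b x) = cubeDiff k (fun y => f (Fin.cons b y)) x := by
  simp [cubeDiff, Fin.cons_update]

lemma cubeDiff_zero_cons {m : ℕ} (f : (Fin (m + 1) → Bool) → ℝ) (b : Bool) (x : Fin m → Bool) :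
    cubeDiff 0 f (Fin.cons b x) = (f (Fin.cons true x) - f (Fin.cons false x)) / 2 := by
  simp [cubeDiff, Fin.update_cons_zero]

lemma expect_cube_succ {m : ℕ} (f : (Fin (m + 1) → Bool) → ℝ) :
    𝔼 x, f x = (𝔼 x, f (Fin.cons true x) + 𝔼 x, f (Fin.cons false x)) / 2 := by
  have h : 𝔼 x, f x = 𝔼 p : Bool × (Fin m → Bool), f (Fin.cons p.1 p.2) :=
    (Fintype.expect_equiv (Fin.consEquiv fun _ => Bool) _ _ fun _ => rfl).symm
  rw [h, ← Finset.univ_product_univ,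
    Finset.expect_product' Finset.univ Finset.univ fun b x => f (Fin.cons b x),
    Fintype.expect_eq_sum_div_card]
  simp

/-- The two-point logarithmic Sobolev inequality, with a non-optimal constant. -/
lemma two_point_log_sobolev (a b : ℝ) :
    (a ^ 2 * Real.log (a ^ 2) + b ^ 2 * Real.log (b ^ 2)) / 2
      - (a ^ 2 + b ^ 2) / 2 * Real.log ((a ^ 2 + b ^ 2) / 2) ≤ (a - b) ^ 2 := by
  set m := (a ^ 2 + b ^ 2) / 2 with hm
  rcases (by positivity : 0 ≤ m).eq_or_lt with h0 | h0
  · have ha : a = 0 := by nlinarith [sq_nonneg a, sq_nonneg b]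
    have hb : b = 0 := by nlinarith [sq_nonneg a, sq_nonneg b]
    simp [ha, hb, ← h0]
  -- `log s ≤ s - 1` bounds the entropy by the variance of the squares divided by `m`; then `(a + b)
  -- ^ 2 ≤ 4 * m` finishes.
  have key : ∀ t : ℝ, t ^ 2 * Real.log (t ^ 2) - t ^ 2 * Real.log m ≤ t ^ 2 * (t ^ 2 / m - 1) := by
    intro t
    rcases eq_or_ne t 0 with rfl | ht
    · simp
    rw [← mul_sub, ← Real.log_div (by positivity) h0.ne']
    exact mul_le_mul_of_nonneg_left (Real.log_le_sub_one_of_pos (by positivity)) (by positivity)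
  have h1 := key a
  have h2 := key b
  have h3 : (a ^ 2 * (a ^ 2 / m - 1) + b ^ 2 * (b ^ 2 / m - 1)) / 2 ≤ (a - b) ^ 2 := by
    have e : (a ^ 2 * (a ^ 2 / m - 1) + b ^ 2 * (b ^ 2 / m - 1)) / 2
        = ((a ^ 2 - b ^ 2) / 2) ^ 2 / m := by
      field_simp
      rw [hm]; ring
    rw [e, div_le_iff₀ h0, hm]
    nlinarith [sq_nonneg ((a - b) * (a - b))]
  have h4 : m * Real.log m = (a ^ 2 * Real.log m + b ^ 2 * Real.log m) / 2 := by rw [hm]; ring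
  linarith

/-- Reverse triangle inequality in `L²`. It lets the two-point inequality act on the `L²` norms of
the two halves of a cube. -/
lemma sq_sqrt_expect_sub_le {α : Type*} [Fintype α] (u v : α → ℝ) :
    (√(𝔼 x, u x ^ 2) - √(𝔼 x, v x ^ 2)) ^ 2 ≤ 𝔼 x, (u x - v x) ^ 2 := by
  have hu : 0 ≤ 𝔼 x, u x ^ 2 := Finset.expect_nonneg fun _ _ => sq_nonneg _
  have hv : 0 ≤ 𝔼 x, v x ^ 2 := Finset.expect_nonneg fun _ _ => sq_nonneg _
  have hcs : (𝔼 x, u x * v x) ≤ √(𝔼 x, u x ^ 2) * √(𝔼 x, v x ^ 2) := by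
    rw [← Real.sqrt_mul hu]
    exact Real.le_sqrt_of_sq_le (Finset.expect_mul_sq_le_sq_mul_sq _ _ _)
  have e : 𝔼 x, (u x - v x) ^ 2 = 𝔼 x, u x ^ 2 + 𝔼 x, v x ^ 2 - 2 * 𝔼 x, u x * v x := by
    rw [Finset.mul_expect, ← Finset.expect_add_distrib, ← Finset.expect_sub_distrib]
    exact Finset.expect_congr rfl fun _ _ => by ring
  rw [e, sub_sq, Real.sq_sqrt hu, Real.sq_sqrt hv]
  linarith

/-- The logarithmic Sobolev inequality on the Boolean cube, with a non-optimal constant. -/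
lemma log_sobolev_cube {m : ℕ} (g : (Fin m → Bool) → ℝ) :
    𝔼 x, g x ^ 2 * Real.log (g x ^ 2) - (𝔼 x, g x ^ 2) * Real.log (𝔼 x, g x ^ 2)
      ≤ 4 * ∑ k, 𝔼 x, cubeDiff k g x ^ 2 := by
  induction m with
  | zero => simp
  | succ m ih =>
    set u : (Fin m → Bool) → ℝ := fun x => g (Fin.cons true x)
    set v : (Fin m → Bool) → ℝ := fun x => g (Fin.cons false x)
    have hu := ih u
    have hv := ih v
    have hu0 : 0 ≤ 𝔼 x, u x ^ 2 := Finset.expect_nonneg fun _ _ => sq_nonneg _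
    have hv0 : 0 ≤ 𝔼 x, v x ^ 2 := Finset.expect_nonneg fun _ _ => sq_nonneg _
    -- Chain rule for entropy: the whole is the mean of the entropies of the halves plus the
    -- two-point entropy of their `L²` norms.
    have h2 := two_point_log_sobolev (√(𝔼 x, u x ^ 2)) (√(𝔼 x, v x ^ 2))
    rw [Real.sq_sqrt hu0, Real.sq_sqrt hv0] at h2
    have h3 := sq_sqrt_expect_sub_le u v
    rw [Fin.sum_univ_succ]
    simp only [expect_cube_succ (m := m), cubeDiff_succ_cons, cubeDiff_zero_cons]
    change (𝔼 x, u x ^ 2 * Real.log (u x ^ 2) + 𝔼 x, v x ^ 2 * Real.log (v x ^ 2)) / 2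
      - (𝔼 x, u x ^ 2 + 𝔼 x, v x ^ 2) / 2 * Real.log ((𝔼 x, u x ^ 2 + 𝔼 x, v x ^ 2) / 2) ≤
      4 * ((𝔼 x, ((u x - v x) / 2) ^ 2 + 𝔼 x, ((u x - v x) / 2) ^ 2) / 2
        + ∑ k, (𝔼 x, cubeDiff k u x ^ 2 + 𝔼 x, cubeDiff k v x ^ 2) / 2)
    have e1 : 𝔼 x, ((u x - v x) / 2) ^ 2 = (𝔼 x, (u x - v x) ^ 2) / 4 := by
      rw [Finset.expect_div]
      exact Finset.expect_congr rfl fun _ _ => by ring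
    rw [e1, ← Finset.sum_div, Finset.sum_add_distrib]
    linarith

/-- Relative entropy bound: concentration of `g` in `L¹` versus `L²` forces entropy. -/
lemma expect_sq_mul_le_entropy {α : Type*} [Fintype α] [Nonempty α] (g : α → ℝ) {c : ℝ}
    (hc : 0 < c) :
    (𝔼 x, g x ^ 2) * (1 + Real.log c) ≤
      𝔼 x, g x ^ 2 * Real.log (g x ^ 2) - (𝔼 x, g x ^ 2) * Real.log (𝔼 x, g x ^ 2)
        + c * (𝔼 x, |g x|) ^ 2 := by
  set a := 𝔼 x, g x ^ 2 with ha
  set β := 𝔼 x, |g x| with hβ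
  have ha0 : 0 ≤ a := Finset.expect_nonneg fun _ _ => sq_nonneg _
  have hβ0 : 0 ≤ β := Finset.expect_nonneg fun _ _ => abs_nonneg _
  rcases ha0.eq_or_lt with h0 | h0
  · have hg : ∀ x, g x = 0 := by
      intro x
      have := (Finset.expect_eq_zero_iff_of_nonneg (s := Finset.univ)
        (fun i _ => sq_nonneg (g i))).1 h0.symm
      simpa using this x
    have hb : β = 0 := by simp [hβ, hg]
    simp [← h0, hb, hg]
  have hβ1 : 0 < β := by
    refine hβ0.lt_of_ne fun h => h0.ne' ?_
    have := (Finset.expect_eq_zero_iff_of_nonneg (s := Finset.univ)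
        (fun i _ => abs_nonneg (g i))).1 h.symm
    have hg : ∀ x, g x = 0 := fun x => by simpa using this x
    simp [ha, hg]
  -- Pointwise form of Gibbs' inequality for the densities `g ^ 2 / a` and `|g| / β`; averaging
  -- shows that the entropy is at least `a * log (a / β ^ 2)`.
  have hpt : ∀ x, g x ^ 2 * (2 * Real.log (a / β)) - 2 * (a / β * |g x| - g x ^ 2)
      ≤ g x ^ 2 * Real.log (g x ^ 2) := by
    intro x
    rcases eq_or_ne (g x) 0 with h | h
    · simp [h]
    have hp : 0 < |g x| := abs_pos.2 h
    have hl : Real.log (a / β / |g x|) ≤ a / β / |g x| - 1 :=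
      Real.log_le_sub_one_of_pos (by positivity)
    rw [Real.log_div (by positivity) hp.ne', Real.log_abs] at hl
    have hm := mul_le_mul_of_nonneg_left hl (sq_nonneg (g x))
    have e : g x ^ 2 * (a / β / |g x| - 1) = a / β * |g x| - g x ^ 2 := by
      rw [← sq_abs]; field_simp
    rw [e] at hm
    rw [Real.log_pow]
    push_cast
    linarith
  have hE : a * (2 * Real.log (a / β)) ≤ 𝔼 x, g x ^ 2 * Real.log (g x ^ 2) := by
    calc a * (2 * Real.log (a / β))
        = a * (2 * Real.log (a / β)) - 2 * (a / β * β - a) := by field_simp; ring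
      _ = 𝔼 x, (g x ^ 2 * (2 * Real.log (a / β)) - 2 * (a / β * |g x| - g x ^ 2)) := by
          rw [Finset.expect_sub_distrib, ← Finset.mul_expect, Finset.expect_sub_distrib,
            ← Finset.mul_expect, ← Finset.expect_mul]
      _ ≤ _ := Finset.expect_le_expect fun x _ => hpt x
  -- Trades the logarithm of `a / β ^ 2` for a term linear in `β ^ 2`, so that one `c` can serve all
  -- coordinates.
  have hl : Real.log (c * β ^ 2 / a) ≤ c * β ^ 2 / a - 1 :=
    Real.log_le_sub_one_of_pos (by positivity)
  rw [Real.log_div (by positivity) h0.ne', Real.log_mul hc.ne' (by positivity), Real.log_pow] at hl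
  have hm := mul_le_mul_of_nonneg_left hl ha0
  have e : a * (c * β ^ 2 / a - 1) = c * β ^ 2 - a := by field_simp
  rw [e] at hm
  rw [Real.log_div h0.ne' hβ1.ne'] at hE
  push_cast at hm
  linarith

/-- A Talagrand-type `L¹`-`L²` variance bound on the Boolean cube, in linearized form. -/
lemma variance_cube_le_fin {m : ℕ} (f : (Fin m → Bool) → ℝ) {c : ℝ} (hc : 0 < c) :
    (𝔼 x, f x ^ 2 - (𝔼 x, f x) ^ 2) * (1 + Real.log c) ≤
      4 * ∑ k, 𝔼 x, cubeDiff k f x ^ 2 + c * ∑ k, (𝔼 x, |cubeDiff k f x|) ^ 2 := by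
  induction m with
  | zero => simp
  | succ m ih =>
    set u : (Fin m → Bool) → ℝ := fun x => f (Fin.cons true x)
    set v : (Fin m → Bool) → ℝ := fun x => f (Fin.cons false x)
    set w : (Fin m → Bool) → ℝ := fun x => (u x + v x) / 2
    set d : (Fin m → Bool) → ℝ := fun x => (u x - v x) / 2
    -- `w` averages out the first coordinate and `d` is the martingale difference, so the variance
    -- is that of `w` plus `𝔼 d ^ 2`. Induction handles `w`, entropy and log-Sobolev handle `d`; the
    -- energies of `w` and `d` add up to that of `f`.
    have hw := ih w
    have hd := expect_sq_mul_le_entropy d hc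
    have hL := log_sobolev_cube d
    rw [Fin.sum_univ_succ, Fin.sum_univ_succ]
    simp only [expect_cube_succ (m := m), cubeDiff_succ_cons, cubeDiff_zero_cons]
    change ((𝔼 x, u x ^ 2 + 𝔼 x, v x ^ 2) / 2 - ((𝔼 x, u x + 𝔼 x, v x) / 2) ^ 2) * _ ≤
      4 * ((𝔼 x, d x ^ 2 + 𝔼 x, d x ^ 2) / 2
        + ∑ k, (𝔼 x, cubeDiff k u x ^ 2 + 𝔼 x, cubeDiff k v x ^ 2) / 2)
      + c * (((𝔼 x, |d x| + 𝔼 x, |d x|) / 2) ^ 2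
        + ∑ k, ((𝔼 x, |cubeDiff k u x| + 𝔼 x, |cubeDiff k v x|) / 2) ^ 2)
    have e0 : (𝔼 x, u x + 𝔼 x, v x) / 2 = 𝔼 x, w x := by
      rw [← Finset.expect_add_distrib, Finset.expect_div]
    have e1 : (𝔼 x, u x ^ 2 + 𝔼 x, v x ^ 2) / 2 = 𝔼 x, w x ^ 2 + 𝔼 x, d x ^ 2 := by
      rw [← Finset.expect_add_distrib, ← Finset.expect_add_distrib, Finset.expect_div]
      exact Finset.expect_congr rfl fun _ _ => by simp only [w, d]; ring
    have e2 : ∀ k, (𝔼 x, cubeDiff k u x ^ 2 + 𝔼 x, cubeDiff k v x ^ 2) / 2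
        = 𝔼 x, cubeDiff k w x ^ 2 + 𝔼 x, cubeDiff k d x ^ 2 := by
      intro k
      rw [← Finset.expect_add_distrib, ← Finset.expect_add_distrib, Finset.expect_div]
      exact Finset.expect_congr rfl fun _ _ => by simp only [w, d, cubeDiff]; ring
    have e3 : ∀ k, (𝔼 x, |cubeDiff k w x|) ^ 2
        ≤ ((𝔼 x, |cubeDiff k u x| + 𝔼 x, |cubeDiff k v x|) / 2) ^ 2 := by
      intro k
      refine pow_le_pow_left₀ (Finset.expect_nonneg fun _ _ => abs_nonneg _) ?_ 2
      rw [← Finset.expect_add_distrib, Finset.expect_div]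
      refine Finset.expect_le_expect fun x _ => ?_
      have e : cubeDiff k w x = (cubeDiff k u x + cubeDiff k v x) / 2 := by
        simp only [w, cubeDiff]; ring
      rw [e, abs_div, abs_two]
      gcongr
      exact abs_add_le _ _
    have e4 := Finset.sum_le_sum fun k (_ : k ∈ Finset.univ) => e3 k
    rw [e0, e1, Finset.sum_congr rfl fun k _ => e2 k, Finset.sum_add_distrib]
    have e5 := mul_le_mul_of_nonneg_left e4 hc.le
    have e6 : 0 ≤ 𝔼 x, d x ^ 2 := Finset.expect_nonneg fun _ _ => sq_nonneg _
    have e7 : (𝔼 x, |d x| + 𝔼 x, |d x|) / 2 = 𝔼 x, |d x| := by ring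
    rw [e7]
    linarith

lemma variance_cube_le {K : Type*} [Fintype K] [DecidableEq K] (f : (K → Bool) → ℝ) {c : ℝ}
    (hc : 0 < c) :
    (𝔼 x, f x ^ 2 - (𝔼 x, f x) ^ 2) * (1 + Real.log c) ≤
      4 * ∑ k, 𝔼 x, cubeDiff k f x ^ 2 + c * ∑ k, (𝔼 x, |cubeDiff k f x|) ^ 2 := by
  let e := Fintype.equivFin K
  let E : (Fin (Fintype.card K) → Bool) ≃ (K → Bool) := e.symm.arrowCongr (Equiv.refl Bool)
  have hE : ∀ h : (K → Bool) → ℝ, 𝔼 x, h x = 𝔼 y, h (E y) := fun h =>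
    (Fintype.expect_equiv E _ _ fun _ => rfl).symm
  have hD : ∀ k y, cubeDiff k f (E y) = cubeDiff (e k) (fun y => f (E y)) y := by
    intro k y
    have : ∀ b, Function.update (E y) k b = E (Function.update y (e k) b) := by
      intro b
      ext j
      by_cases h : j = k
      · subst h; simp [E]
      · simp [E, h]
    simp [cubeDiff, this]
  have h := variance_cube_le_fin (fun y => f (E y)) hc
  rw [← e.sum_comp, ← e.sum_comp] at h
  simpa only [hE, hD] using h

/-! ### Mollification preserving symmetry -/

/-- A bump that depends only on `∑ i, x i ^ 2` is invariant under permutations of the coordinates,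
and so convolution with it keeps such symmetries. -/
lemma exists_symmetric_mollifier {ι : Type*} [Fintype ι] {ε : ℝ} (hε : 0 < ε) :
    ∃ φ : (ι → ℝ) → ℝ, ContDiff ℝ 1 φ ∧ HasCompactSupport φ ∧ (∀ x, 0 ≤ φ x) ∧ ∫ x, φ x = 1 ∧
      (∀ x, φ x ≠ 0 → √(∑ i, x i ^ 2) ≤ ε) ∧
      ∀ (e : Equiv.Perm ι) (x : ι → ℝ), φ (fun i => x (e i)) = φ x := by
  let ψ : (ι → ℝ) → ℝ := fun x => Real.smoothTransition (1 - (∑ i, x i ^ 2) / ε ^ 2)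
  have hψ : ContDiff ℝ 1 ψ := Real.smoothTransition.contDiff.comp (by fun_prop)
  have hsupp : ∀ x, ψ x ≠ 0 → ∑ i, x i ^ 2 ≤ ε ^ 2 := by
    intro x hx
    by_contra! h
    refine hx (Real.smoothTransition.zero_of_nonpos ?_)
    rw [sub_nonpos, one_le_div (by positivity)]
    exact h.le
  have hsupp' : ∀ x, ψ x ≠ 0 → √(∑ i, x i ^ 2) ≤ ε := fun x hx =>
    (Real.sqrt_le_left hε.le).2 (hsupp x hx)
  have hcpt : HasCompactSupport ψ := by
    refine HasCompactSupport.intro (isCompact_closedBall (0 : ι → ℝ) ε) fun x hx => ?_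
    by_contra h
    refine hx ?_
    rw [mem_closedBall_zero_iff, pi_norm_le_iff_of_nonneg hε.le]
    intro i
    refine abs_le_of_sq_le_sq (le_trans ?_ (hsupp x h)) hε.le
    exact Finset.single_le_sum (f := fun i => x i ^ 2) (fun _ _ => sq_nonneg _) (Finset.mem_univ i)
  have hnn : ∀ x, 0 ≤ ψ x := fun x => Real.smoothTransition.nonneg _
  have hpos : 0 < ∫ x, ψ x := by
    refine hψ.continuous.integral_pos_of_hasCompactSupport_nonneg_nonzero hcpt hnn (x := 0) ?_
    simp [ψ]
  refine ⟨fun x => (∫ x, ψ x)⁻¹ * ψ x, contDiff_const.mul hψ, hcpt.mul_left,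
    fun x => mul_nonneg (inv_nonneg.2 hpos.le) (hnn x), ?_, ?_, ?_⟩
  · rw [integral_const_mul, inv_mul_cancel₀ hpos.ne']
  · intro x hx
    exact hsupp' x (right_ne_zero_of_mul hx)
  · intro e x
    simp only [ψ]
    rw [Equiv.sum_comp e fun i => x i ^ 2]

lemma abs_le_sqrt_sum_sq {ι : Type*} [Fintype ι] (x : ι → ℝ) (i : ι) : |x i| ≤ √(∑ i, x i ^ 2) :=
  Real.abs_le_sqrt
    (Finset.single_le_sum (f := fun i => x i ^ 2) (fun _ _ => sq_nonneg _) (Finset.mem_univ i))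

lemma sqrt_sum_sq_le_card_mul_norm {ι : Type*} [Fintype ι] (x : ι → ℝ) :
    √(∑ i, x i ^ 2) ≤ √(Fintype.card ι) * ‖x‖ := by
  rw [Real.sqrt_le_left (by positivity), mul_pow, Real.sq_sqrt (by positivity)]
  calc ∑ i, x i ^ 2 ≤ ∑ _i : ι, ‖x‖ ^ 2 := Finset.sum_le_sum fun i _ => by
        rw [← sq_abs]; exact pow_le_pow_left₀ (abs_nonneg _) (norm_le_pi_norm x i) 2
    _ = _ := by simp

open scoped Convolution in
/-- A function that is Lipschitz for the Euclidean norm is a uniform limit of functions with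
Lipschitz derivative, with the same bounds and the same permutation symmetries. -/
lemma exists_smooth_approx {ι : Type*} [Fintype ι] {f : (ι → ℝ) → ℝ}
    (hf : ∀ x y, |f x - f y| ≤ √(∑ i, (x i - y i) ^ 2)) {ε : ℝ} (hε : 0 < ε) :
    ∃ (g : (ι → ℝ) → ℝ) (g' : (ι → ℝ) → ((ι → ℝ) →L[ℝ] ℝ)),
      (∀ x, HasFDerivAt g (g' x) x) ∧ (∃ K, 0 ≤ K ∧ ∀ x y, ‖g' x - g' y‖ ≤ K * ‖x - y‖) ∧
      (∀ x, |g x - f x| ≤ ε) ∧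
      (∀ p : (ι → ℝ) → ℝ, (∀ x y, |f x - f y| ≤ p (x - y)) → ∀ x y, |g x - g y| ≤ p (x - y)) ∧
      (∀ R, (∀ x, |f x| ≤ R) → ∀ x, |g x| ≤ R) ∧
      ∀ e : Equiv.Perm ι, (∀ x, f (fun i => x (e i)) = f x) →
        ∀ x, g (fun i => x (e i)) = g x := by
  obtain ⟨φ, hφ, hcpt, hnn, hint, hsupp, hsymm⟩ := exists_symmetric_mollifier (ι := ι) hε
  have hlip : LipschitzWith (NNReal.sqrt (Fintype.card ι)) f := by
    refine LipschitzWith.of_dist_le_mul fun x y => ?_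
    rw [Real.dist_eq, dist_eq_norm]
    simpa using (hf x y).trans (sqrt_sum_sq_le_card_mul_norm (x - y))
  have hcont : Continuous f := hlip.continuous
  let L := ContinuousLinearMap.lsmul ℝ ℝ (E := ℝ)
  let g := φ ⋆[L, volume] f
  let g' := fderiv ℝ φ ⋆[L.precompL (ι → ℝ), volume] f
  have hg : ∀ x, g x = ∫ t, φ t * f (x - t) := fun x => rfl
  have hi : ∀ x, Integrable (fun t => φ t * f (x - t)) := fun x =>
    hcpt.convolutionExists_left L hφ.continuous (hcont.locallyIntegrable) x
  have hφi : Integrable φ := hφ.continuous.integrable_of_hasCompactSupport hcpt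
  have hdiff : ∀ (h : (ι → ℝ) → ℝ) (b : ℝ), Integrable (fun t => φ t * h t) →
      (∀ t, φ t ≠ 0 → |h t| ≤ b) → |∫ t, φ t * h t| ≤ b := by
    intro h b hhi hb
    calc |∫ t, φ t * h t| ≤ ∫ t, |φ t * h t| := abs_integral_le_integral_abs
      _ ≤ ∫ t, φ t * b := by
        refine integral_mono hhi.abs (hφi.mul_const b) fun t => ?_
        simp only [abs_mul, abs_of_nonneg (hnn t)]
        by_cases ht : φ t = 0
        · simp [ht]
        · exact mul_le_mul_of_nonneg_left (hb t ht) (hnn t)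
      _ = b := by rw [integral_mul_const, hint, one_mul]
  refine ⟨g, g', fun x => hcpt.hasFDerivAt_convolution_left L hφ hcont.locallyIntegrable x,
    ⟨(∫ t, ‖fderiv ℝ φ t‖) * √(Fintype.card ι), by positivity, ?_⟩,
    ?_, ?_, ?_, ?_⟩
  · intro x y
    have hi' : ∀ x, Integrable (fun t => L.precompL (ι → ℝ) (fderiv ℝ φ t) (f (x - t))) := fun x =>
      (hcpt.fderiv ℝ).convolutionExists_left _ (hφ.continuous_fderiv one_ne_zero)
        hcont.locallyIntegrable x
    have hφ'i : Integrable (fun t => ‖fderiv ℝ φ t‖) :=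
      ((hφ.continuous_fderiv one_ne_zero).integrable_of_hasCompactSupport (hcpt.fderiv ℝ)).norm
    -- The derivative falls on `φ`, so the Lipschitz bound of `f` becomes one for `g'`.
    have e : g' x - g' y
        = ∫ t, L.precompL (ι → ℝ) (fderiv ℝ φ t) (f (x - t) - f (y - t)) := by
      simp only [map_sub]
      exact (integral_sub (hi' x) (hi' y)).symm
    rw [e]
    calc _ ≤ ∫ t, ‖L.precompL (ι → ℝ) (fderiv ℝ φ t) (f (x - t) - f (y - t))‖ :=
          norm_integral_le_integral_norm _
      _ ≤ ∫ t, ‖fderiv ℝ φ t‖ * (√(Fintype.card ι) * ‖x - y‖) := by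
        refine integral_mono_of_nonneg (Filter.Eventually.of_forall fun t => norm_nonneg _)
          (hφ'i.mul_const _) (Filter.Eventually.of_forall fun t => ?_)
        have h1 : ‖f (x - t) - f (y - t)‖ ≤ √(Fintype.card ι) * ‖x - y‖ := by
          have := hlip.dist_le_mul (x - t) (y - t)
          rw [dist_eq_norm, dist_eq_norm] at this
          simpa using this
        have h2 : L.precompL (ι → ℝ) (fderiv ℝ φ t) (f (x - t) - f (y - t))
            = (f (x - t) - f (y - t)) • fderiv ℝ φ t := by
          ext v
          simp [L, mul_comm (fderiv ℝ φ t v), sub_mul]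
        simp only [h2, norm_smul, mul_comm ‖f (x - t) - f (y - t)‖]
        exact mul_le_mul_of_nonneg_left h1 (norm_nonneg _)
      _ = _ := by rw [integral_mul_const]; ring
  · intro x
    have e : g x - f x = ∫ t, φ t * (f (x - t) - f x) := by
      simp only [mul_sub]
      rw [integral_sub (hi x) (hφi.mul_const _), integral_mul_const, hint, one_mul, hg]
    rw [e]
    refine hdiff _ _ ?_ fun t ht => (hf _ _).trans ?_
    · simp only [mul_sub]; exact (hi x).sub (hφi.mul_const _)
    · simpa using hsupp t ht
  · intro p hp x y
    -- An average of translates inherits any translation-invariant modulus `p`.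
    have e : g x - g y = ∫ t, φ t * (f (x - t) - f (y - t)) := by
      simp only [mul_sub]
      rw [integral_sub (hi x) (hi y), hg, hg]
    rw [e]
    refine hdiff _ _ ?_ fun t _ => (hp _ _).trans ?_
    · simp only [mul_sub]; exact (hi x).sub (hi y)
    · simp
  · intro R hR x
    exact hdiff _ _ (hi x) fun t _ => hR _
  · intro e he x
    rw [hg, hg, ← (volume_measurePreserving_piCongrLeft (fun _ : ι => ℝ) e.symm).integral_comp']
    refine integral_congr_ae (Filter.Eventually.of_forall fun t => ?_)
    have ht : (MeasurableEquiv.piCongrLeft (fun _ : ι => ℝ) e.symm) t = fun i => t (e i) := by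
      ext i
      have := Equiv.piCongrLeft_apply_apply (fun _ : ι => ℝ) e.symm t (e i)
      rwa [e.symm_apply_apply] at this
    simp only [ht, hsymm]
    rw [← he (x - t)]
    rfl

/-! ### Gradient bounds from Lipschitz bounds -/

/-- Restrict `g` to the line through `x` in direction `v`. Only homogeneity of `p` matters, so the
Euclidean and the row norm are treated alike. -/
lemma HasFDerivAt.abs_apply_le_of_homogeneous {E : Type*} [NormedAddCommGroup E] [NormedSpace ℝ E]
    {g : E → ℝ} {G : E →L[ℝ] ℝ} {x : E} (hG : HasFDerivAt g G x) {p : E → ℝ}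
    (hp : ∀ (t : ℝ) v, p (t • v) = |t| * p v) (hg : ∀ y, |g y - g x| ≤ p (y - x)) (v : E) :
    |G v| ≤ p v := by
  have hpv : 0 ≤ p v := by
    have := (abs_nonneg _).trans (hg (x + v))
    simpa using this
  have hline : HasDerivAt (fun t : ℝ => x + t • v) v 0 := by
    simpa using ((hasDerivAt_id (0 : ℝ)).smul_const v).const_add x
  have hd : HasDerivAt (fun t : ℝ => g (x + t • v)) (G v) 0 := by
    have hG' : HasFDerivAt g G (x + (0 : ℝ) • v) := by simpa using hG
    exact hG'.comp_hasDerivAt (0 : ℝ) hline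
  refine hd.le_of_lip' hpv (Filter.Eventually.of_forall fun t => ?_)
  have := hg (x + t • v)
  rw [add_sub_cancel_left, hp] at this
  simpa [mul_comm] using this

/-- Minkowski's inequality for averages. -/
lemma sum_sq_expect_abs_le {α β : Type*} [Fintype α] [Fintype β] (u : β → α → ℝ) :
    ∑ j, (𝔼 x, |u j x|) ^ 2 ≤ (𝔼 x, √(∑ j, u j x ^ 2)) ^ 2 := by
  set b : β → ℝ := fun j => 𝔼 x, |u j x|
  set r := 𝔼 x, √(∑ j, u j x ^ 2)
  have hr : 0 ≤ r := Finset.expect_nonneg fun _ _ => Real.sqrt_nonneg _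
  have hB0 : 0 ≤ ∑ j, b j ^ 2 := Finset.sum_nonneg fun _ _ => sq_nonneg _
  have h : ∑ j, b j ^ 2 ≤ √(∑ j, b j ^ 2) * r := by
    calc ∑ j, b j ^ 2 = 𝔼 x, ∑ j, b j * |u j x| := by
          rw [Finset.expect_sum_comm]
          refine Finset.sum_congr rfl fun j _ => ?_
          rw [← Finset.mul_expect, sq]
      _ ≤ 𝔼 x, √(∑ j, b j ^ 2) * √(∑ j, u j x ^ 2) := by
          refine Finset.expect_le_expect fun x _ => ?_
          have := Real.sum_mul_le_sqrt_mul_sqrt Finset.univ b fun j => |u j x|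
          simpa only [sq_abs] using this
      _ = _ := by rw [← Finset.mul_expect]
  have hs := Real.sq_sqrt hB0
  have hB : √(∑ j, b j ^ 2) ≤ r := by
    rcases (Real.sqrt_nonneg (∑ j, b j ^ 2)).eq_or_lt with h0 | h0
    · rw [← h0]; exact hr
    · refine le_of_mul_le_mul_left ?_ h0
      nlinarith
  rw [← hs]
  exact pow_le_pow_left₀ (Real.sqrt_nonneg _) hB 2

section Gradient

variable {α β : Type*} [Fintype α] [Fintype β]

/-- The maximal Euclidean norm of a row. -/
noncomputable def maxRowNorm (v : α × β → ℝ) : ℝ := ‖fun i => √(∑ j, v (i, j) ^ 2)‖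

lemma maxRowNorm_smul (t : ℝ) (v : α × β → ℝ) : maxRowNorm (t • v) = |t| * maxRowNorm v := by
  have : (fun i => √(∑ j, (t • v) (i, j) ^ 2)) = |t| • fun i => √(∑ j, v (i, j) ^ 2) := by
    ext i
    simp only [Pi.smul_apply, smul_eq_mul, mul_pow, ← Finset.mul_sum]
    rw [Real.sqrt_mul (sq_nonneg t), Real.sqrt_sq_eq_abs]
  rw [maxRowNorm, this, norm_smul, Real.norm_eq_abs, abs_abs, maxRowNorm]

lemma sqrt_sum_sq_smul {ι : Type*} [Fintype ι] (t : ℝ) (v : ι → ℝ) :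
    √(∑ i, (t • v) i ^ 2) = |t| * √(∑ i, v i ^ 2) := by
  simp only [Pi.smul_apply, smul_eq_mul, mul_pow, ← Finset.mul_sum]
  rw [Real.sqrt_mul (sq_nonneg t), Real.sqrt_sq_eq_abs]

lemma ContinuousLinearMap.pi_apply_eq_sum_single {ι : Type*} [Fintype ι] [DecidableEq ι]
    (G : (ι → ℝ) →L[ℝ] ℝ) (v : ι → ℝ) : G v = ∑ k, v k * G (Pi.single k 1) := by
  conv_lhs => rw [pi_eq_sum_univ' v]
  rw [map_sum]
  refine Finset.sum_congr rfl fun k _ => ?_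
  rw [map_smul, smul_eq_mul]

/-- Testing the derivative on the gradient itself gives `|∇g|² ≤ |∇g|`. -/
lemma sum_sq_partial_le_one {ι : Type*} [Fintype ι] [DecidableEq ι] {g : (ι → ℝ) → ℝ}
    {G : (ι → ℝ) →L[ℝ] ℝ} {x : ι → ℝ} (hG : HasFDerivAt g G x)
    (hg : ∀ x y, |g x - g y| ≤ √(∑ i, (x i - y i) ^ 2)) :
    ∑ k, G (Pi.single k 1) ^ 2 ≤ 1 := by
  have h := hG.abs_apply_le_of_homogeneous (p := fun v => √(∑ i, v i ^ 2)) sqrt_sum_sq_smul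
    (fun y => hg y x) fun k => G (Pi.single k 1)
  rw [G.pi_apply_eq_sum_single] at h
  simp only [← sq] at h
  have h0 : 0 ≤ ∑ k, G (Pi.single k 1) ^ 2 := Finset.sum_nonneg fun _ _ => sq_nonneg _
  rw [abs_of_nonneg h0] at h
  have hs := Real.sq_sqrt h0
  nlinarith [Real.sqrt_nonneg (∑ k, G (Pi.single k 1) ^ 2)]

/-- Duality between the maximum and the sum of row norms: the test direction is the gradient with
each row normalized. Zero rows stay zero because `0⁻¹ = 0`. -/
lemma sum_row_partial_le [DecidableEq α] [DecidableEq β] {g : (α × β → ℝ) → ℝ}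
    {G : (α × β → ℝ) →L[ℝ] ℝ} {x : α × β → ℝ} (hG : HasFDerivAt g G x) {L : ℝ} (hL : 0 ≤ L)
    (hg : ∀ x y, |g x - g y| ≤ L * maxRowNorm (x - y)) :
    ∑ i, √(∑ j, G (Pi.single (i, j) 1) ^ 2) ≤ L := by
  set r : α → ℝ := fun i => √(∑ j, G (Pi.single (i, j) 1) ^ 2)
  have hr : ∀ i, r i ^ 2 = ∑ j, G (Pi.single (i, j) 1) ^ 2 := fun i =>
    Real.sq_sqrt (Finset.sum_nonneg fun _ _ => sq_nonneg _)
  have h := hG.abs_apply_le_of_homogeneous (p := fun v => L * maxRowNorm v)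
    (fun t v => by rw [maxRowNorm_smul]; ring)
    (fun y => hg y x) fun k => (r k.1)⁻¹ * G (Pi.single k 1)
  rw [G.pi_apply_eq_sum_single, Fintype.sum_prod_type] at h
  have e : ∀ i, ∑ j, (r i)⁻¹ * G (Pi.single (i, j) 1) * G (Pi.single (i, j) 1) = r i := by
    intro i
    rw [Finset.sum_congr rfl fun j _ => by rw [mul_assoc, ← sq], ← Finset.mul_sum, ← hr]
    rcases eq_or_ne (r i) 0 with h0 | h0
    · simp [h0]
    · field_simp
  simp only [e] at h
  refine (le_abs_self _).trans (h.trans (mul_le_of_le_one_right hL ?_))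
  rw [maxRowNorm, pi_norm_le_iff_of_nonneg zero_le_one]
  intro i
  simp only [mul_pow, ← Finset.mul_sum, ← hr]
  rw [Real.norm_eq_abs, abs_of_nonneg (Real.sqrt_nonneg _), ← mul_pow,
    Real.sqrt_sq_eq_abs]
  rcases eq_or_ne (r i) 0 with h0 | h0
  · simp [h0]
  · rw [inv_mul_cancel₀ h0]; simp

lemma partial_comp_perm {ι : Type*} [Fintype ι] [DecidableEq ι] {g : (ι → ℝ) → ℝ}
    {g' : (ι → ℝ) → ((ι → ℝ) →L[ℝ] ℝ)} (hg' : ∀ x, HasFDerivAt g (g' x) x) (e : Equiv.Perm ι)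
    (he : ∀ x, g (fun i => x (e i)) = g x) (x : ι → ℝ) (k : ι) :
    g' (fun i => x (e i)) (Pi.single k 1) = g' x (Pi.single (e k) 1) := by
  let T : (ι → ℝ) →L[ℝ] (ι → ℝ) := ContinuousLinearMap.pi fun i => ContinuousLinearMap.proj (e i)
  have h1 : HasFDerivAt (fun x => g (T x)) ((g' (T x)).comp T) x :=
    (hg' (T x)).comp x T.hasFDerivAt
  have h2 : (fun x => g (T x)) = g := funext he
  rw [h2] at h1
  have h3 := h1.unique (hg' x)
  rw [← h3]
  change g' (T x) _ = g' (T x) _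
  congr 1
  ext j
  simp [T, Pi.single_apply]

end Gradient

/-! ### Functions of normalized sums of signs -/

/-- The sign of a Boolean. -/
def boolSign (b : Bool) : ℝ := if b then 1 else -1

/-- Normalized sums of signs. -/
noncomputable def signSum {ι : Type*} {n : ℕ} (x : ι × Fin n → Bool) (k : ι) : ℝ :=
  (√n)⁻¹ * ∑ l, boolSign (x (k, l))

section SignSum

variable {ι : Type*} [DecidableEq ι] {n : ℕ}

lemma signSum_update (x : ι × Fin n → Bool) (k : ι) (l : Fin n) (b : Bool) :
    signSum (Function.update x (k, l) b) - signSum x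
      = ((√n)⁻¹ * (boolSign b - boolSign (x (k, l)))) • Pi.single k 1 := by
  ext j
  simp only [signSum, Pi.sub_apply, Pi.smul_apply, smul_eq_mul, ← mul_sub,
    ← Finset.sum_sub_distrib, mul_assoc]
  congr 1
  rcases eq_or_ne j k with rfl | hj
  · rw [Finset.sum_eq_single l]
    · simp
    · intro m _ hm
      rw [Function.update_of_ne (by simpa using hm), sub_self]
    · simp
  · simp [hj, Function.update_of_ne]

variable [Fintype ι]

lemma norm_signSum_update_sub_le (x : ι × Fin n → Bool) (k : ι) (l : Fin n) (b : Bool) :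
    ‖signSum (Function.update x (k, l) b) - signSum x‖ ≤ 2 * (√n)⁻¹ := by
  rw [signSum_update, norm_smul, Pi.norm_single, norm_one, mul_one, norm_mul, Real.norm_eq_abs,
    abs_of_nonneg (by positivity), mul_comm]
  refine mul_le_mul_of_nonneg_right ?_ (by positivity)
  cases b <;> cases x (k, l) <;> norm_num [boolSign]

/-- Flipping one sign moves the sum by `2 / √n` along one axis, inside a ball on which `g'` varies
by at most `2 * K / √n`; the mean value inequality applies. -/
lemma abs_cubeDiff_comp_signSum_le {g : (ι → ℝ) → ℝ} {g' : (ι → ℝ) → ((ι → ℝ) →L[ℝ] ℝ)}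
    (hg' : ∀ x, HasFDerivAt g (g' x) x) {K : ℝ} (hK0 : 0 ≤ K)
    (hK : ∀ x y, ‖g' x - g' y‖ ≤ K * ‖x - y‖) (x : ι × Fin n → Bool) (k : ι) (l : Fin n) :
    |cubeDiff (k, l) (fun x => g (signSum x)) x|
      ≤ (√n)⁻¹ * (|g' (signSum x) (Pi.single k 1)| + 2 * K * (√n)⁻¹) := by
  set a := signSum x
  set y := signSum (Function.update x (k, l) true) with hy
  set z := signSum (Function.update x (k, l) false) with hz
  have hball : ∀ b, signSum (Function.update x (k, l) b) ∈ Metric.closedBall a (2 * (√n)⁻¹) := by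
    intro b
    rw [mem_closedBall_iff_norm]
    exact norm_signSum_update_sub_le x k l b
  have hyz : y - z = (2 * (√n)⁻¹) • Pi.single k 1 := by
    have e : y - z = (y - a) - (z - a) := by abel
    rw [e, hy, hz, signSum_update, signSum_update, ← sub_smul]
    congr 1
    simp only [boolSign]
    norm_num
    ring
  have h := (convex_closedBall a (2 * (√n)⁻¹)).norm_image_sub_le_of_norm_hasFDerivWithin_le'
    (f := g) (f' := g') (φ := g' a) (C := K * (2 * (√n)⁻¹)) (fun w _ => (hg' w).hasFDerivWithinAt)
    (fun w hw => (hK w a).trans (mul_le_mul_of_nonneg_left (mem_closedBall_iff_norm.1 hw) hK0))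
    (hball false) (hball true)
  rw [← hy, ← hz, hyz, map_smul, norm_smul, Pi.norm_single, norm_one, mul_one, smul_eq_mul,
    Real.norm_eq_abs, Real.norm_eq_abs,
    abs_of_nonneg (by positivity : 0 ≤ 2 * (√(n : ℝ))⁻¹)] at h
  change |(g y - g z) / 2| ≤ _
  have h2 := abs_le.1 h
  have h3 := mul_le_mul_of_nonneg_left (le_abs_self (g' a (Pi.single k 1)))
    (by positivity : 0 ≤ (√n)⁻¹)
  have h4 := mul_le_mul_of_nonneg_left (neg_abs_le (g' a (Pi.single k 1)))
    (by positivity : 0 ≤ (√n)⁻¹)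
  rw [abs_le]
  constructor <;> nlinarith

end SignSum

section Energy

variable {ι T : Type*} [Fintype ι] [Fintype T] [Nonempty T] {n : ℕ} {D : ι × Fin n → T → ℝ}
  {G : ι → T → ℝ} {κ : ℝ}

/-- The `n` signs feeding coordinate `k` contribute `1 / n` each, so the cube energy is that of `G`
up to the error in `(|G| + κ) ^ 2 ≤ G ^ 2 + 2 * κ + κ ^ 2`. -/
lemma sum_expect_sq_le_of_abs_le (hn : 0 < n)
    (hD : ∀ k l x, |D (k, l) x| ≤ (√n)⁻¹ * (|G k x| + κ)) (hκ : 0 ≤ κ) (hG : ∀ k x, |G k x| ≤ 1) :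
    ∑ k, 𝔼 x, D k x ^ 2 ≤ ∑ k, 𝔼 x, G k x ^ 2 + Fintype.card ι * (2 * κ + κ ^ 2) := by
  have hn' : (0 : ℝ) < n := by exact_mod_cast hn
  have hsq : (√n)⁻¹ ^ 2 * n = 1 := by
    rw [inv_pow, Real.sq_sqrt hn'.le, inv_mul_cancel₀ hn'.ne']
  have h1 : ∀ k l, 𝔼 x, D (k, l) x ^ 2 ≤ (√n)⁻¹ ^ 2 * (𝔼 x, G k x ^ 2 + (2 * κ + κ ^ 2)) := by
    intro k l
    calc _ ≤ 𝔼 x, (√n)⁻¹ ^ 2 * (G k x ^ 2 + (2 * κ + κ ^ 2)) := by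
          refine Finset.expect_le_expect fun x _ => ?_
          have h := pow_le_pow_left₀ (abs_nonneg _) (hD k l x) 2
          rw [sq_abs, mul_pow] at h
          refine h.trans (mul_le_mul_of_nonneg_left ?_ (by positivity))
          have := hG k x
          rw [← sq_abs (G k x)]
          nlinarith
      _ = _ := by rw [← Finset.mul_expect, Finset.expect_add_distrib, Fintype.expect_const]
  calc _ = ∑ k, ∑ l, 𝔼 x, D (k, l) x ^ 2 := Fintype.sum_prod_type _
    _ ≤ ∑ k : ι, ∑ _l : Fin n, (√n)⁻¹ ^ 2 * (𝔼 x, G k x ^ 2 + (2 * κ + κ ^ 2)) :=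
        Finset.sum_le_sum fun k _ => Finset.sum_le_sum fun l _ => h1 k l
    _ = ∑ k, (𝔼 x, G k x ^ 2 + (2 * κ + κ ^ 2)) := by
        refine Finset.sum_congr rfl fun k _ => ?_
        rw [Finset.sum_const, Finset.card_univ, Fintype.card_fin, nsmul_eq_mul, ← mul_assoc,
          mul_comm (n : ℝ), hsq, one_mul]
    _ = _ := by
        rw [Finset.sum_add_distrib, Finset.sum_const, Finset.card_univ, nsmul_eq_mul]

lemma sum_sq_expect_le_of_abs_le (hn : 0 < n)
    (hD : ∀ k l x, |D (k, l) x| ≤ (√n)⁻¹ * (|G k x| + κ)) (hκ : 0 ≤ κ) (hG : ∀ k x, |G k x| ≤ 1) :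
    ∑ k, (𝔼 x, |D k x|) ^ 2 ≤ ∑ k, (𝔼 x, |G k x|) ^ 2 + Fintype.card ι * (2 * κ + κ ^ 2) := by
  have hn' : (0 : ℝ) < n := by exact_mod_cast hn
  have hsq : (√n)⁻¹ ^ 2 * n = 1 := by
    rw [inv_pow, Real.sq_sqrt hn'.le, inv_mul_cancel₀ hn'.ne']
  have h1 : ∀ k l, (𝔼 x, |D (k, l) x|) ^ 2
      ≤ (√n)⁻¹ ^ 2 * ((𝔼 x, |G k x|) ^ 2 + (2 * κ + κ ^ 2)) := by
    intro k l
    have h2 : 𝔼 x, |D (k, l) x| ≤ (√n)⁻¹ * (𝔼 x, |G k x| + κ) := by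
      calc _ ≤ 𝔼 x, (√n)⁻¹ * (|G k x| + κ) := Finset.expect_le_expect fun x _ => hD k l x
        _ = _ := by rw [← Finset.mul_expect, Finset.expect_add_distrib, Fintype.expect_const]
    have h3 : 𝔼 x, |G k x| ≤ 1 := Finset.expect_le Finset.univ_nonempty fun x _ => hG k x
    have h := pow_le_pow_left₀ (Finset.expect_nonneg fun _ _ => abs_nonneg _) h2 2
    rw [mul_pow] at h
    refine h.trans (mul_le_mul_of_nonneg_left ?_ (by positivity))
    nlinarith
  calc _ = ∑ k, ∑ l, (𝔼 x, |D (k, l) x|) ^ 2 := Fintype.sum_prod_type _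
    _ ≤ ∑ k : ι, ∑ _l : Fin n, (√n)⁻¹ ^ 2 * ((𝔼 x, |G k x|) ^ 2 + (2 * κ + κ ^ 2)) :=
        Finset.sum_le_sum fun k _ => Finset.sum_le_sum fun l _ => h1 k l
    _ = ∑ k, ((𝔼 x, |G k x|) ^ 2 + (2 * κ + κ ^ 2)) := by
        refine Finset.sum_congr rfl fun k _ => ?_
        rw [Finset.sum_const, Finset.card_univ, Fintype.card_fin, nsmul_eq_mul, ← mul_assoc,
          mul_comm (n : ℝ), hsq, one_mul]
    _ = _ := by
        rw [Finset.sum_add_distrib, Finset.sum_const, Finset.card_univ, nsmul_eq_mul]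

end Energy

section SignSumVariance

variable {α β : Type*} [Fintype α] [Fintype β] [DecidableEq α] [DecidableEq β] [Nonempty α]
  {g : (α × β → ℝ) → ℝ} {g' : (α × β → ℝ) → ((α × β → ℝ) →L[ℝ] ℝ)} {L : ℝ} {n : ℕ}

/-- Swapping two rows preserves both `g` and the uniform measure, so all rows have the same expected
gradient norm, while the row norms sum to at most `L` pointwise. -/
lemma expect_row_partial_le (hg' : ∀ x, HasFDerivAt g (g' x) x) (hL : 0 ≤ L)
    (hgL : ∀ x y, |g x - g y| ≤ L * maxRowNorm (x - y))
    (hsymm : ∀ (τ : Equiv.Perm α) x, g (fun k => x (τ k.1, k.2)) = g x) (i : α) :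
    𝔼 x : (α × β) × Fin n → Bool, √(∑ j, g' (signSum x) (Pi.single (i, j) 1) ^ 2)
      ≤ L / Fintype.card α := by
  set r : α → ((α × β) × Fin n → Bool) → ℝ :=
    fun i x => √(∑ j, g' (signSum x) (Pi.single (i, j) 1) ^ 2)
  have heq : ∀ i', 𝔼 x, r i' x = 𝔼 x, r i x := by
    intro i'
    let e : Equiv.Perm (α × β) := (Equiv.swap i i').prodCongr (Equiv.refl β)
    let e' : Equiv.Perm ((α × β) × Fin n) := e.prodCongr (Equiv.refl _)
    refine Fintype.expect_equiv (e'.symm.arrowCongr (Equiv.refl Bool)) _ _ fun x => ?_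
    have hS : signSum ((e'.symm.arrowCongr (Equiv.refl Bool)) x) = fun k => signSum x (e k) := by
      ext k
      rfl
    simp only [r, hS]
    congr 1
    refine Finset.sum_congr rfl fun j _ => ?_
    rw [partial_comp_perm hg' e (fun x => hsymm (Equiv.swap i i') x)]
    simp [e]
  have hcard : (0 : ℝ) < Fintype.card α := by exact_mod_cast Fintype.card_pos
  rw [le_div_iff₀ hcard]
  calc _ = ∑ i', 𝔼 x, r i' x := by
        simp only [heq, Finset.sum_const, Finset.card_univ, nsmul_eq_mul, mul_comm]
        rfl
    _ = 𝔼 x, ∑ i', r i' x := (Finset.expect_sum_comm _ _ _).symm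
    _ ≤ L := Finset.expect_le Finset.univ_nonempty fun x _ => sum_row_partial_le (hg' _) hL hgL

/-- The variance bound for a smooth function of normalized sums of signs, up to an error that
vanishes as the number of summands grows. -/
lemma variance_comp_signSum_le (hg' : ∀ x, HasFDerivAt g (g' x) x) {K : ℝ} (hK0 : 0 ≤ K)
    (hK : ∀ x y, ‖g' x - g' y‖ ≤ K * ‖x - y‖)
    (hg : ∀ x y, |g x - g y| ≤ √(∑ i, (x i - y i) ^ 2)) (hL : 0 ≤ L)
    (hgL : ∀ x y, |g x - g y| ≤ L * maxRowNorm (x - y))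
    (hsymm : ∀ (τ : Equiv.Perm α) x, g (fun k => x (τ k.1, k.2)) = g x)
    (hn : 0 < n) {c : ℝ} (hc : 0 < c) :
    ((𝔼 x : (α × β) × Fin n → Bool, g (signSum x) ^ 2)
      - (𝔼 x : (α × β) × Fin n → Bool, g (signSum x)) ^ 2) * (1 + Real.log c) ≤
      4 + c * (L ^ 2 / Fintype.card α) + (4 + c) * (Fintype.card (α × β) *
        (2 * (2 * K * (√n)⁻¹) + (2 * K * (√n)⁻¹) ^ 2)) := by
  have hκ : 0 ≤ 2 * K * (√n)⁻¹ := by positivity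
  set G : α × β → ((α × β) × Fin n → Bool) → ℝ := fun k x => g' (signSum x) (Pi.single k 1) with hG
  have hsum : ∀ x, ∑ k, G k x ^ 2 ≤ 1 := fun x => sum_sq_partial_le_one (hg' _) hg
  have hG1 : ∀ k x, |G k x| ≤ 1 := fun k x => by
    rw [← sq_le_one_iff_abs_le_one]
    exact (Finset.single_le_sum (f := fun k => G k x ^ 2) (fun _ _ => sq_nonneg _)
      (Finset.mem_univ k)).trans (hsum x)
  have hD : ∀ k l x, |cubeDiff (k, l) (fun x : (α × β) × Fin n → Bool => g (signSum x)) x|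
      ≤ (√n)⁻¹ * (|G k x| + 2 * K * (√n)⁻¹) := fun k l x =>
    abs_cubeDiff_comp_signSum_le hg' hK0 hK x k l
  have key := variance_cube_le (fun x : (α × β) × Fin n → Bool => g (signSum x)) hc
  have hE := sum_expect_sq_le_of_abs_le
    (D := fun k => cubeDiff k fun x : (α × β) × Fin n → Bool => g (signSum x)) hn hD hκ hG1
  have hW := sum_sq_expect_le_of_abs_le
    (D := fun k => cubeDiff k fun x : (α × β) × Fin n → Bool => g (signSum x)) hn hD hκ hG1
  have hE' : ∑ k, 𝔼 x, G k x ^ 2 ≤ 1 := by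
    rw [← Finset.expect_sum_comm]
    exact Finset.expect_le Finset.univ_nonempty fun x _ => hsum x
  have hcard : (0 : ℝ) < Fintype.card α := by exact_mod_cast Fintype.card_pos
  -- By Minkowski's inequality each row contributes at most the square of its expected gradient
  -- norm.
  have hW' : ∑ k, (𝔼 x, |G k x|) ^ 2 ≤ L ^ 2 / Fintype.card α := by
    calc _ = ∑ i, ∑ j, (𝔼 x, |G (i, j) x|) ^ 2 := Fintype.sum_prod_type _
      _ ≤ ∑ _i : α, (L / Fintype.card α) ^ 2 := Finset.sum_le_sum fun i _ => by
          refine (sum_sq_expect_abs_le fun j x => G (i, j) x).trans ?_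
          exact pow_le_pow_left₀ (Finset.expect_nonneg fun _ _ => Real.sqrt_nonneg _)
            (expect_row_partial_le hg' hL hgL hsymm i) 2
      _ = _ := by
          rw [Finset.sum_const, Finset.card_univ, nsmul_eq_mul]
          field_simp
  have := mul_le_mul_of_nonneg_left (hW.trans (add_le_add_left hW' _)) hc.le
  linarith

end SignSumVariance

/-! ### Central limit theorem and passage to Gaussian matrices -/

open Filter Topology

/-- The law of a fair coin. -/
noncomputable def coin : Measure Bool := (PMF.uniformOfFintype Bool).toMeasure

instance : IsProbabilityMeasure coin := inferInstanceAs
  (IsProbabilityMeasure (PMF.uniformOfFintype Bool).toMeasure)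

lemma coin_singleton (b : Bool) : coin {b} = 2⁻¹ := by
  rw [coin, PMF.toMeasure_apply_singleton _ _ (measurableSet_singleton b)]
  simp

lemma integral_coin (f : Bool → ℝ) : ∫ b, f b ∂coin = (f true + f false) / 2 := by
  rw [integral_fintype .of_finite]
  simp [Measure.real, coin_singleton]
  ring

/-- The law of a normalized sum of `n` independent signs. -/
noncomputable def signSumLaw (n : ℕ) : Measure ℝ :=
  (Measure.pi fun _ : Fin n => coin).map fun x => (√n)⁻¹ * ∑ l, boolSign (x l)

instance (n : ℕ) : IsProbabilityMeasure (signSumLaw n) :=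
  Measure.isProbabilityMeasure_map (measurable_of_finite _).aemeasurable

lemma charFun_signSumLaw (n : ℕ) (t : ℝ) :
    charFun (signSumLaw n) t = charFun (coin.map boolSign) ((√n)⁻¹ * t) ^ n := by
  have hi : iIndepFun (fun (l : Fin n) (x : Fin n → Bool) => boolSign (x l))
      (Measure.pi fun _ => coin) :=
    iIndepFun_pi (X := fun _ => boolSign) fun _ => (measurable_of_finite _).aemeasurable
  rw [signSumLaw, charFun_map_mul_comp (measurable_of_finite _).aemeasurable,
    hi.charFun_map_fun_sum_eq_prod fun _ => (measurable_of_finite _).aemeasurable]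
  have : ∀ l : Fin n, (Measure.pi fun _ : Fin n => coin).map (fun x => boolSign (x l))
      = coin.map boolSign := by
    intro l
    have h := (measurePreserving_eval (fun _ : Fin n => coin) l).map_eq
    calc _ = ((Measure.pi fun _ : Fin n => coin).map (Function.eval l)).map boolSign :=
          (Measure.map_map (g := boolSign) (measurable_of_finite _) (measurable_pi_apply l)).symm
      _ = _ := by rw [h]
  simp [this]

lemma tendsto_signSumLaw :
    Tendsto (β := ProbabilityMeasure ℝ) (fun n => ⟨signSumLaw n, inferInstance⟩) atTop
      (𝓝 ⟨gaussianReal 0 1, inferInstance⟩) := by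
  refine ProbabilityMeasure.tendsto_iff_tendsto_charFun.2 fun t => ?_
  have h := tendsto_charFun_inv_sqrt_mul_pow (P := coin) (X := boolSign)
    (measurable_of_finite _).aemeasurable (by rw [integral_coin]; simp [boolSign])
    (by rw [integral_coin]; simp [boolSign]) t
  simpa [charFun_signSumLaw, charFun_gaussianReal, neg_div] using h

lemma integral_eq_expect_of_singleton {T : Type*} [Fintype T] [MeasurableSpace T]
    [MeasurableSingletonClass T] (μ : Measure T) [IsProbabilityMeasure μ]
    (h : ∀ x y, μ {x} = μ {y}) (f : T → ℝ) : ∫ x, f x ∂μ = 𝔼 x, f x := by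
  have : Nonempty T := μ.nonempty_of_neZero
  have h1 : ∀ x, μ.real {x} = (Fintype.card T : ℝ)⁻¹ := by
    intro x
    have hs : ∑ y, μ.real {y} = 1 := by
      rw [sum_measureReal_singleton]
      simp
    have he : ∀ y, μ.real {y} = μ.real {x} := fun y => by rw [Measure.real, Measure.real, h y x]
    simp only [he, Finset.sum_const, Finset.card_univ, nsmul_eq_mul] at hs
    exact eq_inv_of_mul_eq_one_right hs
  rw [integral_fintype .of_finite, Fintype.expect_eq_sum_div_card, div_eq_inv_mul, Finset.mul_sum]
  simp [h1]

/-- Currying turns the uniform cube into a product over `ι` of smaller cubes, so the coordinates of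
`signSum` are independent. -/
lemma expect_signSum_eq_integral {ι : Type*} [Fintype ι] [DecidableEq ι] (n : ℕ) {h : (ι → ℝ) → ℝ}
    (hh : Continuous h) :
    𝔼 x : ι × Fin n → Bool, h (signSum x) = ∫ y, h y ∂(Measure.pi fun _ : ι => signSumLaw n) := by
  have hmap : (Measure.pi fun _ : ι => signSumLaw n) =
      (Measure.pi fun _ : ι => Measure.pi fun _ : Fin n => coin).map
        fun x k => (√n)⁻¹ * ∑ l, boolSign (x k l) :=
    (Measure.pi_map_pi (fun _ => (measurable_of_finite _).aemeasurable)).symm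
  rw [hmap, integral_map (measurable_of_finite _).aemeasurable hh.aestronglyMeasurable,
    integral_eq_expect_of_singleton]
  · exact Fintype.expect_equiv (Equiv.curry ι (Fin n) Bool) _ _ fun x => rfl
  · intro x y
    rw [Measure.pi_singleton, Measure.pi_singleton]
    simp [Measure.pi_singleton, coin_singleton]

/-- The multivariate central limit theorem for normalized sums of signs. -/
lemma tendsto_expect_signSum {ι : Type*} [Fintype ι] [DecidableEq ι] {h : (ι → ℝ) → ℝ} (hh : Continuous h) {R : ℝ}
    (hR : ∀ x, |h x| ≤ R) :
    Tendsto (fun n => 𝔼 x : ι × Fin n → Bool, h (signSum x)) atTop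
      (𝓝 (∫ y, h y ∂(Measure.pi fun _ : ι => gaussianReal 0 1))) := by
  simp only [expect_signSum_eq_integral _ hh]
  have h1 := (ProbabilityMeasure.continuous_pi (ι := ι) (α := fun _ => ℝ)).continuousAt.tendsto.comp
    (tendsto_pi_nhds.2 fun _ : ι => tendsto_signSumLaw)
  have h2 := ProbabilityMeasure.tendsto_iff_forall_integral_tendsto.1 h1
    (BoundedContinuousFunction.ofNormedAddCommGroup h hh R hR)
  exact h2

/-- The variance bound for bounded smooth functions of a Gaussian matrix. -/
lemma gaussian_variance_le_of_smooth {α β : Type*} [Fintype α] [Fintype β] [Nonempty α]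
    {g : (α × β → ℝ) → ℝ} {g' : (α × β → ℝ) → ((α × β → ℝ) →L[ℝ] ℝ)}
    (hg' : ∀ x, HasFDerivAt g (g' x) x) {K : ℝ} (hK0 : 0 ≤ K)
    (hK : ∀ x y, ‖g' x - g' y‖ ≤ K * ‖x - y‖) {R : ℝ} (hR : ∀ x, |g x| ≤ R)
    (hg : ∀ x y, |g x - g y| ≤ √(∑ i, (x i - y i) ^ 2)) {L : ℝ} (hL : 0 ≤ L)
    (hgL : ∀ x y, |g x - g y| ≤ L * maxRowNorm (x - y))
    (hsymm : ∀ (τ : Equiv.Perm α) x, g (fun k => x (τ k.1, k.2)) = g x) {c : ℝ} (hc : 0 < c) :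
    ((∫ x, g x ^ 2 ∂(Measure.pi fun _ : α × β => gaussianReal 0 1))
      - (∫ x, g x ∂(Measure.pi fun _ : α × β => gaussianReal 0 1)) ^ 2) * (1 + Real.log c) ≤
      4 + c * (L ^ 2 / Fintype.card α) := by
  classical
  have hcont : Continuous g := continuous_iff_continuousAt.2 fun x => (hg' x).continuousAt
  have h1 := tendsto_expect_signSum hcont hR
  have h2 := tendsto_expect_signSum (hcont.pow 2) (R := R ^ 2) fun x => by
    rw [Pi.pow_apply, abs_pow]
    exact pow_le_pow_left₀ (abs_nonneg _) (hR x) 2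
  have hs : Tendsto (fun n : ℕ => (√(n : ℝ))⁻¹) atTop (𝓝 0) :=
    tendsto_inv_atTop_zero.comp (Real.tendsto_sqrt_atTop.comp tendsto_natCast_atTop_atTop)
  have hκ : Tendsto (fun n : ℕ => 2 * K * (√(n : ℝ))⁻¹) atTop (𝓝 0) := by
    simpa using hs.const_mul (2 * K)
  -- `K` is fixed as `n` grows, so the discretization error vanishes.
  have hr := ((((hκ.const_mul 2).add (hκ.pow 2)).const_mul
    (Fintype.card (α × β) : ℝ)).const_mul (4 + c)).const_add (4 + c * (L ^ 2 / Fintype.card α))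
  simp only [mul_zero, ne_eq, OfNat.ofNat_ne_zero, not_false_eq_true, zero_pow, add_zero] at hr
  refine le_of_tendsto_of_tendsto ((h2.sub (h1.pow 2)).mul_const (1 + Real.log c)) hr ?_
  filter_upwards [eventually_gt_atTop 0] with n hn
  exact variance_comp_signSum_le hg' hK0 hK hg hL hgL hsymm hn hc

/-! ### Removing boundedness and smoothness -/

section Lipschitz

variable {ι : Type*} [Fintype ι] {f : (ι → ℝ) → ℝ}

lemma continuous_of_abs_sub_le (hf : ∀ x y, |f x - f y| ≤ √(∑ i, (x i - y i) ^ 2)) :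
    Continuous f := by
  refine (LipschitzWith.of_dist_le_mul (K := NNReal.sqrt (Fintype.card ι)) fun x y => ?_).continuous
  rw [Real.dist_eq, dist_eq_norm]
  simpa using (hf x y).trans (sqrt_sum_sq_le_card_mul_norm (x - y))

lemma abs_le_of_abs_sub_le (hf : ∀ x y, |f x - f y| ≤ √(∑ i, (x i - y i) ^ 2)) (x : ι → ℝ) :
    |f x| ≤ |f 0| + √(∑ i, x i ^ 2) := by
  have h := hf x 0
  simp only [Pi.zero_apply, sub_zero] at h
  have := abs_sub_abs_le_abs_sub (f x) (f 0)
  linarith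

/-- This square-integrable envelope gives both the finite second moment and the domination needed
for limits. -/
lemma memLp_two_abs_add_sqrt_sum_sq (a : ℝ) :
    MemLp (fun x : ι → ℝ => a + √(∑ i, x i ^ 2)) 2 (Measure.pi fun _ : ι => gaussianReal 0 1) := by
  have hi : ∀ i : ι, MemLp (fun x : ι → ℝ => x i) 2 (Measure.pi fun _ : ι => gaussianReal 0 1) :=
    fun i => (memLp_id_gaussianReal (μ := 0) (v := 1) 2).comp_measurePreserving
      (measurePreserving_eval (fun _ : ι => gaussianReal 0 1) i)
  have hs : Integrable (fun x : ι → ℝ => ∑ i, x i ^ 2)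
      (Measure.pi fun _ : ι => gaussianReal 0 1) :=
    integrable_finsetSum _ fun i _ => (hi i).integrable_sq
  refine (memLp_const a).add ((memLp_two_iff_integrable_sq ?_).2 ?_)
  · exact (Continuous.measurable (by fun_prop)).aestronglyMeasurable
  · simpa only [Real.sq_sqrt (Finset.sum_nonneg fun i _ => sq_nonneg _)] using hs

lemma memLp_two_of_abs_sub_le (hf : ∀ x y, |f x - f y| ≤ √(∑ i, (x i - y i) ^ 2)) :
    MemLp f 2 (Measure.pi fun _ : ι => gaussianReal 0 1) :=
  (memLp_two_abs_add_sqrt_sum_sq |f 0|).of_le (continuous_of_abs_sub_le hf).aestronglyMeasurable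
    (Eventually.of_forall fun x => (abs_le_of_abs_sub_le hf x).trans (le_abs_self _))

end Lipschitz

lemma abs_clamp_sub_clamp_le (a b m : ℝ) :
    |max (min a m) (-m) - max (min b m) (-m)| ≤ |a - b| := by
  refine (abs_max_sub_max_le_abs _ _ _).trans ((abs_min_sub_min_le_max _ _ _ _).trans ?_)
  simp

lemma abs_clamp_le {m : ℝ} (hm : 0 ≤ m) (a : ℝ) : |max (min a m) (-m)| ≤ m :=
  abs_le.2 ⟨le_max_right _ _, max_le (min_le_right _ _) (by linarith)⟩

/-- Variance bound for a row-symmetric Lipschitz function of a Gaussian matrix, in terms of its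
Lipschitz constant for the maximal row norm. -/
lemma gaussian_variance_le {α β : Type*} [Fintype α] [Fintype β] [Nonempty α]
    {f : (α × β → ℝ) → ℝ} (hf : ∀ x y, |f x - f y| ≤ √(∑ i, (x i - y i) ^ 2)) {L : ℝ} (hL : 0 ≤ L)
    (hfL : ∀ x y, |f x - f y| ≤ L * maxRowNorm (x - y))
    (hsymm : ∀ (τ : Equiv.Perm α) x, f (fun k => x (τ k.1, k.2)) = f x) {c : ℝ} (hc : 0 < c) :
    variance f (Measure.pi fun _ : α × β => gaussianReal 0 1) * (1 + Real.log c) ≤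
      4 + c * (L ^ 2 / Fintype.card α) := by
  have hmem := memLp_two_of_abs_sub_le hf
  set γ : Measure (α × β → ℝ) := Measure.pi fun _ => gaussianReal 0 1 with hγ
  have hclamp : ∀ (m : ℕ) x y, |max (min (f x) m) (-m) - max (min (f y) m) (-m)| ≤ |f x - f y| :=
    fun m x y => abs_clamp_sub_clamp_le _ _ _
  -- Clamp to `[-m, m]`, then mollify at scale `1 / (m + 1)`.
  have hex := fun m : ℕ => exists_smooth_approx (f := fun x => max (min (f x) m) (-m))
    (fun x y => (hclamp m x y).trans (hf x y)) (Nat.one_div_pos_of_nat (α := ℝ) (n := m))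
  choose g g' hg' hK happrox hp hR hperm using hex
  have hvar : ∀ m, ((∫ x, g m x ^ 2 ∂γ) - (∫ x, g m x ∂γ) ^ 2) * (1 + Real.log c) ≤
      4 + c * (L ^ 2 / Fintype.card α) := by
    intro m
    obtain ⟨K, hK0, hK⟩ := hK m
    refine gaussian_variance_le_of_smooth (hg' m) hK0 hK
      (hR m m fun x => abs_clamp_le m.cast_nonneg _)
      (hp m (fun v => √(∑ i, v i ^ 2)) fun x y => (hclamp m x y).trans (hf x y)) hL
      (hp m (fun v => L * maxRowNorm v) fun x y => (hclamp m x y).trans (hfL x y)) ?_ hc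
    intro τ
    exact hperm m (τ.prodCongr (Equiv.refl β)) fun x => by
      have := hsymm τ x
      change max (min (f fun k => x (τ k.1, k.2)) _) _ = _
      rw [this]
  have hgc : ∀ m, Continuous (g m) := fun m =>
    continuous_iff_continuousAt.2 fun x => (hg' m x).continuousAt
  have hlim : ∀ x, Tendsto (fun m => g m x) atTop (𝓝 (f x)) := by
    intro x
    refine tendsto_iff_norm_sub_tendsto_zero.2
      (squeeze_zero' (Eventually.of_forall fun m => norm_nonneg _) ?_
        tendsto_one_div_add_atTop_nhds_zero_nat)
    filter_upwards [eventually_ge_atTop ⌈|f x|⌉₊] with m hm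
    have h := abs_le.1 (Nat.ceil_le.1 hm)
    have hx : max (min (f x) m) (-m) = f x := by rw [min_eq_left h.2, max_eq_left h.1]
    simpa [hx] using happrox m x
  set H : (α × β → ℝ) → ℝ := fun x => (|f 0| + 1) + √(∑ i, x i ^ 2)
  have hH : MemLp H 2 γ := memLp_two_abs_add_sqrt_sum_sq _
  have hbound : ∀ m x, |g m x| ≤ H x := by
    intro m x
    have h1 := abs_sub_abs_le_abs_sub (g m x) (max (min (f x) m) (-m))
    have h2 := happrox m x
    have h3 : (1 : ℝ) / (m + 1) ≤ 1 := by
      rw [div_le_one (by positivity)]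
      linarith [m.cast_nonneg (α := ℝ)]
    have h4 : |max (min (f x) m) (-m)| ≤ |f x| := by
      have := abs_clamp_sub_clamp_le (f x) 0 m
      simpa using this
    have h5 := abs_le_of_abs_sub_le hf x
    simp only [H]
    linarith
  have h1 : Tendsto (fun m => ∫ x, g m x ∂γ) atTop (𝓝 (∫ x, f x ∂γ)) :=
    tendsto_integral_of_dominated_convergence H (fun m => (hgc m).aestronglyMeasurable)
      (hH.integrable one_le_two) (fun m => Eventually.of_forall fun x => hbound m x)
      (Eventually.of_forall hlim)
  have h2 : Tendsto (fun m => ∫ x, g m x ^ 2 ∂γ) atTop (𝓝 (∫ x, f x ^ 2 ∂γ)) := by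
    refine tendsto_integral_of_dominated_convergence (fun x => H x ^ 2)
      (fun m => ((hgc m).pow 2).aestronglyMeasurable) hH.integrable_sq
      (fun m => Eventually.of_forall fun x => ?_)
      (Eventually.of_forall fun x => (hlim x).pow 2)
    rw [norm_pow]
    exact pow_le_pow_left₀ (norm_nonneg _) (hbound m x) 2
  rw [variance_eq_sub hmem]
  exact le_of_tendsto' ((h2.sub (h1.pow 2)).mul_const _) hvar

/-! ### Comparison of `ℓ^q` norms -/

section LqNorm

variable {ι : Type*} [Fintype ι] {q : ℝ≥0∞}

lemma PiLp.norm_toLp_le_card_rpow_mul (hq : 1 ≤ q) {v : ι → ℝ} {r : ℝ} (hr : 0 ≤ r)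
    (hv : ∀ i, |v i| ≤ r) :
    ‖WithLp.toLp q v‖ ≤ (Fintype.card ι : ℝ) ^ (1 / q).toReal * r := by
  rcases eq_or_ne q ⊤ with rfl | htop
  · rw [PiLp.norm_eq_ciSup]
    simpa using Real.iSup_le hv hr
  have hp : 0 < q.toReal := ENNReal.toReal_pos (by positivity) htop
  rw [PiLp.norm_eq_sum hp, ENNReal.toReal_div, ENNReal.toReal_one]
  calc _ ≤ (Fintype.card ι * r ^ q.toReal) ^ (1 / q.toReal) := by
        refine Real.rpow_le_rpow (Finset.sum_nonneg fun i _ => by positivity) ?_ (by positivity)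
        calc _ ≤ ∑ _i : ι, r ^ q.toReal := Finset.sum_le_sum fun i _ =>
              Real.rpow_le_rpow (norm_nonneg _) (hv i) hp.le
          _ = _ := by simp
    _ = _ := by
        rw [Real.mul_rpow (by positivity) (by positivity), ← Real.rpow_mul hr,
          mul_one_div_cancel hp.ne', Real.rpow_one]

/-- For finite `q`, `|v i| ^ q ≤ s ^ (q - 2) * v i ^ 2` with `s` the Euclidean norm; the exponent `q
- 2` must be nonnegative. -/
lemma PiLp.norm_toLp_le_sqrt_sum_sq (hq : 2 ≤ q) (v : ι → ℝ) :
    ‖WithLp.toLp q v‖ ≤ √(∑ i, v i ^ 2) := by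
  set s := √(∑ i, v i ^ 2) with hs
  have hs0 : 0 ≤ s := Real.sqrt_nonneg _
  have hv : ∀ i, |v i| ≤ s := abs_le_sqrt_sum_sq v
  rcases eq_or_ne q ⊤ with rfl | htop
  · rw [PiLp.norm_eq_ciSup]
    exact Real.iSup_le hv hs0
  have hp2 : 2 ≤ q.toReal := by simpa using ENNReal.toReal_mono htop hq
  have hp : 0 < q.toReal := by linarith
  have hpow : ∀ t : ℝ, 0 ≤ t → t ^ q.toReal = t ^ (q.toReal - 2) * t ^ 2 := by
    intro t ht
    rw [← Real.rpow_natCast, ← Real.rpow_add_of_nonneg ht (by linarith) (by norm_num)]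
    norm_num
  rw [PiLp.norm_eq_sum hp]
  calc _ ≤ (s ^ q.toReal) ^ (1 / q.toReal) := by
        refine Real.rpow_le_rpow (Finset.sum_nonneg fun i _ => by positivity) ?_ (by positivity)
        calc _ ≤ ∑ i, s ^ (q.toReal - 2) * v i ^ 2 := Finset.sum_le_sum fun i _ => by
              change |v i| ^ q.toReal ≤ _
              rw [hpow _ (abs_nonneg _), sq_abs]
              exact mul_le_mul_of_nonneg_right
                (Real.rpow_le_rpow (abs_nonneg _) (hv i) (by linarith)) (sq_nonneg _)
          _ = s ^ q.toReal := by
              rw [← Finset.mul_sum, hpow s hs0, hs,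
                Real.sq_sqrt (Finset.sum_nonneg fun _ _ => sq_nonneg _)]
    _ = s := by rw [← Real.rpow_mul hs0, mul_one_div_cancel hp.ne', Real.rpow_one]

lemma PiLp.norm_toLp_comp_perm (π : Equiv.Perm ι) (v : ι → ℝ) :
    ‖WithLp.toLp q (fun i => v (π i))‖ = ‖WithLp.toLp q v‖ := by
  rcases eq_or_ne q 0 with rfl | h0
  · rw [PiLp.norm_eq_card, PiLp.norm_eq_card]
    congr 1
    rw [← Nat.card_eq_card_finite_toFinset, ← Nat.card_eq_card_finite_toFinset]
    exact Nat.card_congr (π.subtypeEquiv fun i => Iff.rfl)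
  rcases eq_or_ne q ⊤ with rfl | htop
  · rw [PiLp.norm_eq_ciSup, PiLp.norm_eq_ciSup]
    exact π.iSup_congr fun _ => rfl
  have hp : 0 < q.toReal := ENNReal.toReal_pos h0 htop
  rw [PiLp.norm_eq_sum hp, PiLp.norm_eq_sum hp]
  congr 1
  exact Equiv.sum_comp π fun i => ‖v i‖ ^ q.toReal

end LqNorm

/-! ### Lipschitz bounds and symmetry of the margin -/

section Margin

variable {M N : ℕ} {q : ℝ≥0∞} {Q : Set (EuclideanSpace ℝ (Fin N))} {E : Set (Fin M → ℝ)}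

lemma lqDist_nonneg (x : Fin M → ℝ) [Fact (1 ≤ q)] : 0 ≤ lqDist q x E :=
  Real.iInf_nonneg fun _ => norm_nonneg _

lemma lqDist_le_add [Fact (1 ≤ q)] (hE : E.Nonempty) (x y : Fin M → ℝ) :
    lqDist q x E ≤ lqDist q y E + ‖WithLp.toLp q (x - y)‖ := by
  have : Nonempty E := hE.to_subtype
  rw [← sub_le_iff_le_add]
  refine le_ciInf fun z => ?_
  rw [sub_le_iff_le_add]
  refine ciInf_le_of_le ⟨0, by rintro _ ⟨w, rfl⟩; exact norm_nonneg _⟩ z ?_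
  have e : WithLp.toLp q (x - (z : Fin M → ℝ))
      = WithLp.toLp q (y - (z : Fin M → ℝ)) + WithLp.toLp q (x - y) := by
    rw [← WithLp.toLp_add]
    congr 1
    abel
  rw [e]
  exact norm_add_le _ _

lemma lqDist_comp_perm (hE : PermutationSymmetric E) (π : Equiv.Perm (Fin M)) (x : Fin M → ℝ) :
    lqDist q (fun i => x (π i)) E = lqDist q x E := by
  let e : E ≃ E :=
    { toFun := fun y => ⟨fun i => y.1 (π i), (hE π y.1).1 y.2⟩
      invFun := fun y => ⟨fun i => y.1 (π.symm i), (hE π.symm y.1).1 y.2⟩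
      left_inv := fun y => by ext i; simp
      right_inv := fun y => by ext i; simp }
  refine (e.iInf_congr fun y => ?_).symm
  exact PiLp.norm_toLp_comp_perm π (x - y.1)

lemma margin_le_add [Fact (1 ≤ q)] (hQ : Q.Nonempty) (hE : E.Nonempty)
    (A B : Matrix (Fin M) (Fin N) ℝ) {r : ℝ}
    (h : ∀ σ ∈ Q, ‖WithLp.toLp q (A *ᵥ σ.ofLp - B *ᵥ σ.ofLp)‖ ≤ r) :
    margin q Q E A ≤ margin q Q E B + r := by
  have : Nonempty Q := hQ.to_subtype
  rw [← sub_le_iff_le_add]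
  refine le_ciInf fun σ => ?_
  rw [sub_le_iff_le_add]
  refine ciInf_le_of_le ⟨0, by rintro _ ⟨w, rfl⟩; exact lqDist_nonneg _⟩ σ ?_
  exact (lqDist_le_add hE _ _).trans (add_le_add_right (h σ σ.2) _)

lemma abs_margin_sub_le [Fact (1 ≤ q)] (hQ : Q.Nonempty) (hE : E.Nonempty)
    (A B : Matrix (Fin M) (Fin N) ℝ) {r : ℝ}
    (h : ∀ σ ∈ Q, ‖WithLp.toLp q (A *ᵥ σ.ofLp - B *ᵥ σ.ofLp)‖ ≤ r) :
    |margin q Q E A - margin q Q E B| ≤ r := by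
  have h1 := margin_le_add hQ hE A B h
  have h2 := margin_le_add (q := q) (r := r) hQ hE B A fun σ hσ => by
    rw [← neg_sub, WithLp.toLp_neg, norm_neg]
    exact h σ hσ
  rw [abs_le]
  constructor <;> linarith

/-- Cauchy-Schwarz with `σ` in the unit ball. Both Lipschitz bounds of the margin rest on this
rowwise estimate. -/
lemma sq_mulVec_sub_mulVec_le (hQ : Q ⊆ Metric.closedBall 0 1) (A B : Matrix (Fin M) (Fin N) ℝ)
    {σ : EuclideanSpace ℝ (Fin N)} (hσ : σ ∈ Q) (i : Fin M) :
    (A *ᵥ σ.ofLp - B *ᵥ σ.ofLp) i ^ 2 ≤ ∑ j, (A i j - B i j) ^ 2 := by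
  have h1 : ∑ j, σ.ofLp j ^ 2 ≤ 1 := by
    have h := mem_closedBall_zero_iff.1 (hQ hσ)
    rw [EuclideanSpace.norm_eq, Real.sqrt_le_one] at h
    simpa using h
  have e : (A *ᵥ σ.ofLp - B *ᵥ σ.ofLp) i = ∑ j, (A i j - B i j) * σ.ofLp j := by
    simp [Matrix.mulVec, dotProduct, sub_mul]
  rw [e]
  refine (Finset.sum_mul_sq_le_sq_mul_sq _ _ _).trans (mul_le_of_le_one_right ?_ h1)
  exact Finset.sum_nonneg fun _ _ => sq_nonneg _

lemma margin_submatrix_perm (hE : PermutationSymmetric E) (π : Equiv.Perm (Fin M))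
    (A : Matrix (Fin M) (Fin N) ℝ) : margin q Q E (fun i => A (π i)) = margin q Q E A :=
  iInf_congr fun σ => lqDist_comp_perm hE π (A *ᵥ (σ : EuclideanSpace ℝ (Fin N)).ofLp)

end Margin

theorem theorem1 :
    ∃ C : ℝ, 0 < C ∧
      ∀ (M N : ℕ) (_hM : 1 ≤ M)
        (Q : Set (EuclideanSpace ℝ (Fin N))) (E : Set (Fin M → ℝ))
        (_hQne : Q.Nonempty) (_hQ : Q ⊆ Metric.closedBall 0 1)
        (_hEne : E.Nonempty) (_hE : PermutationSymmetric E)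
        (q : ℝ≥0∞) (_hq : 2 ≤ q)
        (Ω : Type*) [MeasurableSpace Ω] (P : Measure Ω) [IsProbabilityMeasure P]
        (A : Ω → Matrix (Fin M) (Fin N) ℝ) (_hA : IsStdGaussianMatrix A P),
        MemLp (fun ω => margin q Q E (A ω)) 2 P ∧
          variance (fun ω => margin q Q E (A ω)) P ≤
            C / (1 + (1 / 2 - (1 / q).toReal) * Real.log M) := by
  -- 4 comes from the energy term, 1 from the `L¹` term after the choice of `c`.
  refine ⟨5, by norm_num, ?_⟩
  intro M N hM Q E hQne hQ hEne hE q hq Ω _ P _ A hA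
  have hq1 : 1 ≤ q := one_le_two.trans hq
  have : Fact (1 ≤ q) := ⟨hq1⟩
  have : Nonempty (Fin M) := ⟨⟨0, hM⟩⟩
  have hM0 : (0 : ℝ) < M := by exact_mod_cast hM
  set f : (Fin M × Fin N → ℝ) → ℝ := fun x => margin q Q E fun i j => x (i, j)
  have hf : ∀ x y, |f x - f y| ≤ √(∑ k, (x k - y k) ^ 2) := fun x y => by
    refine abs_margin_sub_le hQne hEne _ _ fun σ hσ => ?_
    refine (PiLp.norm_toLp_le_sqrt_sum_sq hq _).trans (Real.sqrt_le_sqrt ?_)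
    rw [Fintype.sum_prod_type]
    exact Finset.sum_le_sum fun i _ => sq_mulVec_sub_mulVec_le hQ _ _ hσ i
  set δ := (1 / q).toReal
  set L := (M : ℝ) ^ δ
  have hL : 0 < L := Real.rpow_pos_of_pos hM0 _
  have hfL : ∀ x y, |f x - f y| ≤ L * maxRowNorm (x - y) := fun x y => by
    refine abs_margin_sub_le hQne hEne _ _ fun σ hσ => ?_
    have h := PiLp.norm_toLp_le_card_rpow_mul hq1 (r := maxRowNorm (x - y)) (norm_nonneg _)
      fun i => ((Real.abs_le_sqrt (sq_mulVec_sub_mulVec_le hQ (fun i j => x (i, j))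
        (fun i j => y (i, j)) hσ i)).trans (le_abs_self _)).trans
        (norm_le_pi_norm (fun i => √(∑ j, (x - y) (i, j) ^ 2)) i)
    simpa only [Fintype.card_fin] using h
  -- `c = M / L ^ 2` makes the `L¹` term equal to 1 and `log c` equal to `2 * (1 / 2 - δ) * log M`.
  have hvar := gaussian_variance_le hf hL.le hfL
    (fun τ x => margin_submatrix_perm hE τ fun i j => x (i, j)) (c := M / L ^ 2) (by positivity)
  have hlaw : HasLaw (fun ω (k : Fin M × Fin N) => A ω k.1 k.2)
      (Measure.pi fun _ => gaussianReal 0 1) P := hA.2.hasLaw_pi fun k => hA.1 k.1 k.2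
  have hmem := memLp_two_of_abs_sub_le hf
  rw [← hlaw.map_eq] at hmem
  refine ⟨hmem.comp_of_map hlaw.aemeasurable, ?_⟩
  rw [← hlaw.map_eq, variance_map hmem.aemeasurable hlaw.aemeasurable] at hvar
  change variance (f ∘ fun ω (k : Fin M × Fin N) => A ω k.1 k.2) P ≤ _
  set V := variance (f ∘ fun ω (k : Fin M × Fin N) => A ω k.1 k.2) P
  have hlog : Real.log (M / L ^ 2) = 2 * ((1 / 2 - δ) * Real.log M) := by
    rw [Real.log_div hM0.ne' (by positivity), Real.log_pow, Real.log_rpow hM0]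
    push_cast
    ring
  have hone : (M : ℝ) / L ^ 2 * (L ^ 2 / Fintype.card (Fin M)) = 1 := by
    rw [Fintype.card_fin]
    field_simp
  have hδ : δ ≤ 1 / 2 := by
    have : (1 / q).toReal ≤ ((2 : ℝ≥0∞)⁻¹).toReal := by
      refine ENNReal.toReal_mono (by simp) ?_
      rw [one_div]
      exact ENNReal.inv_le_inv.2 hq
    rwa [ENNReal.toReal_inv, ENNReal.toReal_ofNat, ← one_div] at this
  have hD : 0 ≤ (1 / 2 - δ) * Real.log M :=
    mul_nonneg (by linarith) (Real.log_nonneg (by exact_mod_cast hM))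
  rw [hlog, hone] at hvar
  have hV : 0 ≤ V := variance_nonneg _ _
  rw [le_div_iff₀ (by linarith)]
  -- The bound carries twice the required logarithm; the surplus is dropped.
  nlinarith [mul_nonneg hV hD]
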